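/- Let $\mathcal C$ be a variety of universal algebras: a signature with a set of operation symbols of each finite arity (including nullary ones) and a set of identities; the empty algebra is allowed if there are no constants. $\mathcal C$ is regarded as a category with all homomorphisms. A category with finite products is called coextensive if for all objects $X,Y$ the canonical functor $\times\colon X/\mathcal C\times Y/\mathcal C\to (X\times Y)/\mathcal C$, $(f,g)\mapsto f\times g$, is an equivalence. Let $F(Z)$ be the free algebra of $\mathcal C$ on a set $Z$; elements of $F(\emptyset)$ are called constants. By an operation we mean a term operation of $\mathcal C$. Let $X=\{x\}\cup\{x_i,x_i' : i\ge 1\}$ be a set of variables and consider the free algebra $P=F\big(X+U(F(\emptyset)^2)\big)$, whose free generators are the variables and the pairs $(\omega,\omega')$ of constants. Theorem. $\mathcal C$ is coextensive if and only if the following holds. There are $k\ge 1$, a $(k+2)$-ary term $t$ and constants $e_1,\dots,e_k,e_1',\dots,e_k'\in F(\emptyset)$ such that (1) the identities $t(x,y,e_1,\dots,e_k)=x$ and $t(x,y,e_1',\dots,e_k')=y$ hold in $\mathcal C$; and, writing $\delta(a,b)=t\big(a,b,(e_1,e_1'),\dots,(e_k,e_k')\big)$ for $a,b\in P$, for every finite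 set $T$ of operations there are natural numbers $n,m$ and elements $\alpha_0,\dots,\alpha_n,\beta_0,\dots,\beta_n\in P$ such that (2) there are $(n+1)$-ary terms $u_0,\dots,u_m$ and, for every $s\in T$, say of arity $l$, $(n+1)$-ary terms $u^{(s)}_0,\dots,u^{(s)}_m$, such that in $P$ \begin{align*} u_0(\beta_0,\dots,\beta_n)&=\delta(x,x), & u_m(\alpha_0,\dots,\alpha_n)&=x,\\ u^{(s)}_0(\beta_0,\dots,\beta_n)&=\delta\big(s(x_1,\dots,x_l),s(x_1',\dots,x_l')\big), & u^{(s)}_m(\alpha_0,\dots,\alpha_n)&=s\big(\delta(x_1,x_1'),\dots,\delta(x_l,x_l')\big), \end{align*} and for all $i<m$: $u_i(\alpha_0,\dots,\alpha_n)=u_{i+1}(\beta_0,\dots,\beta_n)$ and $u^{(s)}_i(\alpha_0,\dots,\alpha_n)=u^{(s)}_{i+1}(\beta_0,\dots,\beta_n)$; (3) for each $j\le n$ one of the following is true: (a) $\alpha_j=\beta_j$; (b) $\alpha_j=(\omega,\omega')$ and $\beta_j=\delta(\omega,\omega')$ for some constants $\omega,\omega'$; (c) the same as (b) with $\alpha_j$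 and $\beta_j$ exchanged; (d) $\alpha_j=v\big(\delta(\omega_1,\omega_1'),\dots,\delta(\omega_l,\omega_l')\big)$ and $\beta_j=\delta\big(v(\omega_1,\dots,\omega_l),v(\omega_1',\dots,\omega_l')\big)$ for some $l\ge 0$, some $l$-ary operation $v$ and some constants $\omega_i,\omega_i'$; (e) the same as (d) with $\alpha_j$ and $\beta_j$ exchanged. The equivalence also holds if $T$ ranges only over the finite sets of basic operations of the signature. (So if the signature is finite, one system $\alpha,\beta$ serves all basic operations at once.) -/

import Mathlib

open CategoryTheory CategoryTheory.Limits

/-! ## Coextensive categories -/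

section Coextensive

universe v₁ u₁

/-- The canonical functor `X/C × Y/C ⥤ (X ⨯ Y)/C`, which sends `(f : X ⟶ B, g : Y ⟶ D)` to
`f ⨯ g : X ⨯ Y ⟶ B ⨯ D`. -/
noncomputable def underProd {C : Type u₁} [Category.{v₁} C] [HasBinaryProducts C] (X Y : C) :
    Under X × Under Y ⥤ Under (X ⨯ Y) where
  obj p := Under.mk (prod.map p.1.hom p.2.hom)
  map f := Under.homMk (prod.map f.1.right f.2.right) (by simp)
  map_id p := by ext; all_goals simp
  map_comp f g := by ext; all_goals simp

/-- A category is coextensive if it has finite products and for all objects `X`, `Y` the canonical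
functor `X/C × Y/C ⥤ (X ⨯ Y)/C` is an equivalence of categories. -/
structure IsCoextensive (C : Type u₁) [Category.{v₁} C] : Prop where
  hasFiniteProducts : HasFiniteProducts C
  isEquivalence_underProd : ∀ X Y : C, (underProd X Y).IsEquivalence

end Coextensive

/-! ## Varieties of universal algebras

A signature is a first-order language `L` without relation symbols; it has a set of operation
symbols of each finite arity (nullary ones are allowed). A variety is given by a set `E` of
identities, that is of pairs of terms in the variables `0, 1, 2, …`. Algebras may be empty if there
are no constants. -/

namespace Variety

universe u v w x y

variable {L : FirstOrder.Language.{u, v}}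

/-- The algebra `A` satisfies all identities in `E`. -/
def Satisfies (E : Set (L.Term ℕ × L.Term ℕ)) (A : Type w) [L.Structure A] : Prop :=
  ∀ p ∈ E, ∀ a : ℕ → A, p.1.realize a = p.2.realize a

/-- The algebras (with carrier in `Type w`) of the variety defined by `E`. -/
structure Alg (E : Set (L.Term ℕ × L.Term ℕ)) : Type (max u v (w + 1)) where
  carrier : Type w
  [str : L.Structure carrier]
  satisfies : Satisfies E carrier

attribute [instance] Alg.str

/-- A variety as a category: the morphisms are all homomorphisms. -/
instance (E : Set (L.Term ℕ × L.Term ℕ)) : Category (Alg.{u, v, w} E) where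
  Hom A B := FirstOrder.Language.Hom L A.carrier B.carrier
  id A := FirstOrder.Language.Hom.id L A.carrier
  comp f g := FirstOrder.Language.Hom.comp g f

/-! ### Free algebras -/

/-- Two terms are equal in the variety: the least congruence on the terms over `X` which contains
all substitution instances of the identities in `E`. -/
inductive TermEq (E : Set (L.Term ℕ × L.Term ℕ)) {X : Type x} : L.Term X → L.Term X → Prop
  | inst (p : L.Term ℕ × L.Term ℕ) (hp : p ∈ E) (σ : ℕ → L.Term X) :
      TermEq E (p.1.subst σ) (p.2.subst σ)
  | refl (a : L.Term X) : TermEq E a a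
  | symm {a b : L.Term X} : TermEq E a b → TermEq E b a
  | trans {a b c : L.Term X} : TermEq E a b → TermEq E b c → TermEq E a c
  | congr {l : ℕ} (f : L.Functions l) (a b : Fin l → L.Term X) :
      (∀ i, TermEq E (a i) (b i)) → TermEq E (FirstOrder.Language.Term.func f a) (FirstOrder.Language.Term.func f b)

/-- `TermEq` as an equivalence relation. -/
def termSetoid (E : Set (L.Term ℕ × L.Term ℕ)) (X : Type x) : Setoid (L.Term X) where
  r := TermEq E
  iseqv := ⟨TermEq.refl, TermEq.symm, TermEq.trans⟩

/-- The free algebra `F(X)` of the variety on the set `X`: terms over `X` modulo the identities of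
the variety. -/
def Free (E : Set (L.Term ℕ × L.Term ℕ)) (X : Type x) : Type (max u x) :=
  Quotient (termSetoid E X)

instance [L.IsAlgebraic] (E : Set (L.Term ℕ × L.Term ℕ)) (X : Type x) :
    L.Prestructure (termSetoid E X) where
  toStructure :=
    { funMap := fun f a => FirstOrder.Language.Term.func f a
      RelMap := fun r _ => isEmptyElim r }
  fun_equiv a b h := TermEq.congr _ a b h
  rel_equiv {_ r} _ _ _ := isEmptyElim r

instance [L.IsAlgebraic] (E : Set (L.Term ℕ × L.Term ℕ)) (X : Type x) : L.Structure (Free E X) :=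
  inferInstanceAs (L.Structure (Quotient (termSetoid E X)))

variable (E : Set (L.Term ℕ × L.Term ℕ))

/-- The free generator of `F(X)` given by `a : X`. -/
def Free.of {X : Type x} (a : X) : Free E X :=
  Quotient.mk (termSetoid E X) (FirstOrder.Language.Term.var a)

variable {E}

theorem TermEq.relabel {X : Type x} {Y : Type y} (g : X → Y) {a b : L.Term X} (h : TermEq E a b) :
    TermEq E (a.relabel g) (b.relabel g) := by
  have key : ∀ (c : L.Term ℕ) (σ : ℕ → L.Term X),
      (c.subst σ).relabel g = c.subst fun i => (σ i).relabel g := by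
    intro c σ
    induction c with
    | var _ => rfl
    | func f _ ih => simp [FirstOrder.Language.Term.subst, FirstOrder.Language.Term.relabel, ih]
  induction h with
  | inst p hp σ => rw [key, key]; exact .inst p hp _
  | refl => exact .refl _
  | symm _ ih => exact ih.symm
  | trans _ _ ih₁ ih₂ => exact ih₁.trans ih₂
  | congr f a b _ ih => exact .congr f _ _ ih

variable (E)

/-- `F(∅)`: the algebra of constants, which is the initial algebra of the variety. -/
abbrev Const : Type u := Free E Empty

variable {E}

/-- The unique homomorphism `F(∅) → F(Y)`: a constant of the variety as an element of `F(Y)`. -/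
def Const.toFree {Y : Type y} (c : Const E) : Free E Y :=
  Quotient.map' (s₁ := termSetoid E Empty) (s₂ := termSetoid E Y)
    (fun a : L.Term Empty => a.relabel Empty.elim) (fun _ _ h => TermEq.relabel _ h) c

/-! ### The syntactic conditions -/

/-- The variables which occur in the chains: `x`, `x₁, x₂, …` and `x₁', x₂', …`. -/
inductive Var : Type
  | x : Var
  | fst (i : ℕ) : Var
  | snd (i : ℕ) : Var

variable (E)

/-- The free algebra `F(X + U(F(∅)²))`, where `X` is the set of variables `Var` and `U(F(∅)²)` is the
set of pairs of constants. -/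
abbrev PairFree : Type u := Free E (Var ⊕ (Const E × Const E))

variable {E}

/-- A variable as an element of `F(X + U(F(∅)²))`. -/
def PairFree.var (a : Var) : PairFree E := Free.of E (Sum.inl a)

/-- The free generator `(ω, ω')` of `F(X + U(F(∅)²))`. -/
def PairFree.pair (ω ω' : Const E) : PairFree E := Free.of E (Sum.inr (ω, ω'))

section

variable [L.IsAlgebraic]

/-- The identities `t(x, y, e₁, …, eₖ) = x` and `t(x, y, e₁', …, eₖ') = y`, where `x`, `y` are the
generators of `F({x, y})`. -/
def IsDiagonalizing {k : ℕ} (t : L.Term (Fin (k + 2))) (e e' : Fin k → Const E) : Prop :=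
  t.realize (Matrix.vecCons (Free.of E (0 : Fin 2)) (Matrix.vecCons (Free.of E (1 : Fin 2))
    fun i => (e i).toFree)) = Free.of E (0 : Fin 2) ∧
  t.realize (Matrix.vecCons (Free.of E (0 : Fin 2)) (Matrix.vecCons (Free.of E (1 : Fin 2))
    fun i => (e' i).toFree)) = Free.of E (1 : Fin 2)

/-- `δ(a, b) = t(a, b, (e₁, e₁'), …, (eₖ, eₖ'))` in `F(X + U(F(∅)²))`. -/
def delta {k : ℕ} (t : L.Term (Fin (k + 2))) (e e' : Fin k → Const E) (a b : PairFree E) :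
    PairFree E :=
  t.realize (Matrix.vecCons a (Matrix.vecCons b fun i => PairFree.pair (e i) (e' i)))

/-- `(a, b) = ((ω, ω'), δ(ω, ω'))` for some constants `ω, ω'`. -/
def IsPairStep {k : ℕ} (t : L.Term (Fin (k + 2))) (e e' : Fin k → Const E) (a b : PairFree E) :
    Prop :=
  ∃ ω ω' : Const E, a = PairFree.pair ω ω' ∧ b = delta t e e' ω.toFree ω'.toFree

/-- `(a, b) = (v(δ(ω₁, ω₁'), …, δ(ωₗ, ωₗ')), δ(v(ω₁, …, ωₗ), v(ω₁', …, ωₗ')))` for some term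
operation `v` and some constants `ωᵢ, ωᵢ'`. -/
def IsOpStep {k : ℕ} (t : L.Term (Fin (k + 2))) (e e' : Fin k → Const E) (a b : PairFree E) :
    Prop :=
  ∃ (l : ℕ) (v : L.Term (Fin l)) (ω ω' : Fin l → Const E),
    a = v.realize (fun i => delta t e e' (ω i).toFree (ω' i).toFree) ∧
    b = delta t e e' (v.realize ω).toFree (v.realize ω').toFree

/-- The elementary forms allowed for a pair `(α, β)`. -/
def IsElementary {k : ℕ} (t : L.Term (Fin (k + 2))) (e e' : Fin k → Const E) (α β : PairFree E) :
    Prop :=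
  α = β ∨ IsPairStep t e e' α β ∨ IsPairStep t e e' β α ∨
    IsOpStep t e e' α β ∨ IsOpStep t e e' β α

/-- There are terms `u₀, …, uₘ` with `u₀(β₀, …, βₙ) = a`, `uₘ(α₀, …, αₙ) = b` and
`uᵢ(α₀, …, αₙ) = uᵢ₊₁(β₀, …, βₙ)` for all `i < m`. -/
def IsLinked {n : ℕ} (α β : Fin (n + 1) → PairFree E) (m : ℕ) (a b : PairFree E) : Prop :=
  ∃ u : Fin (m + 1) → L.Term (Fin (n + 1)),
    (u 0).realize β = a ∧ (u (Fin.last m)).realize α = b ∧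
    ∀ i : Fin m, (u i.castSucc).realize α = (u i.succ).realize β

variable (E)

/-- The syntactic conditions, with `S` the set of operations `s` to be considered. The constants
`e₁, …, eₖ` and `e₁', …, eₖ'` include at least one (`0 < k`), so the variety has a constant. A finite
system of pairs `(αⱼ, βⱼ)` serves `δ(x, x) = x` and any given finitely many `s ∈ S` at once; if `S`
is finite, one system serves all of `S`. -/
def SyntacticCondition (S : Set (Σ l : ℕ, L.Term (Fin l))) : Prop :=
  ∃ (k : ℕ) (t : L.Term (Fin (k + 2))) (e e' : Fin k → Const E),
    0 < k ∧ IsDiagonalizing t e e' ∧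
    ∀ T : Set (Σ l : ℕ, L.Term (Fin l)), T ⊆ S → T.Finite →
      ∃ (n m : ℕ) (α β : Fin (n + 1) → PairFree E),
        (∀ j, IsElementary t e e' (α j) (β j)) ∧
        IsLinked α β m (delta t e e' (.var .x) (.var .x)) (.var .x) ∧
        ∀ s ∈ T, IsLinked α β m
          (delta t e e' (s.2.realize fun i : Fin s.1 => PairFree.var (.fst i))
            (s.2.realize fun i : Fin s.1 => PairFree.var (.snd i)))
          (s.2.realize fun i : Fin s.1 => delta t e e' (.var (.fst i)) (.var (.snd i)))

end

variable (L)

/-- The basic operations `f(y₁, …, yₗ)` of the signature, among all term operations. -/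
def basicOps : Set (Σ l : ℕ, L.Term (Fin l)) :=
  {s | ∃ f : L.Functions s.1, s.2 = FirstOrder.Language.Term.func f FirstOrder.Language.Term.var}

end Variety

universe u v w

/-! Let `I` be the initial algebra `F(∅)`. Everything is governed by algebras `Z` equipped with a
homomorphism `h : I × I → Z`, and by the operation `δ(a, b) = t(a, b, h(e₁, e₁'), …, h(eₖ, eₖ'))` on
them. On a product `A × B` with its canonical `h`, condition (1) says exactly that `δ` is `((a, b),
(c, d)) ↦ (a, d)`.

Necessity. Coextensivity at `X = Y = I` makes every such `Z` a product and every homomorphism under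
`I × I` between products a product of homomorphisms. Applied to a suitable subalgebra of `F({x,
y})²`, this produces `t` (`IsCoextensive.exists_isDiagonalizing`). Since each `Z` is a product, `δ`
is idempotent on it and commutes with all term operations (`IsCoextensive.diag_self`,
`IsCoextensive.diag_realize`). Now take for `Z` the quotient of `P` by the congruence generated by
the elementary pairs of (3); there the generators `(ω, ω')` form a homomorphic image of `I × I`
(`exists_pairQuotient`). Equality in this quotient means being joined by a finite Mal'cev chain,
which is (2).

Sufficiency. Given `Z` and `h`, every assignment of the variables extends to a homomorphism `P → Z`
with `(ω, ω') ↦ h(ω, ω')`. It identifies the two members of each elementary pair, so the chains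
collapse and `δ` is an idempotent homomorphism on `Z`; its compatibility with `t` itself yields the
rectangular law (`SyntacticCondition.exists_isDecomposition`). The congruences `δ(a, b) = b` and
`δ(b, a) = b` then split `Z` into a product, whence essential surjectivity. Homomorphisms that
respect the parameters respect `δ`, whence fullness. Faithfulness needs only a constant, which `k ≥
1` provides. -/

namespace Variety

open FirstOrder FirstOrder.Language FirstOrder.Language.Structure

universe x y

variable {L : FirstOrder.Language.{u, v}}

/-! ### Homomorphisms, products, quotients and lifts of algebras -/

section Algebras

variable {A : Type*} {B : Type*} {C : Type*} [L.Structure A] [L.Structure B] [L.Structure C]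

/-- In an algebraic language, a map compatible with the operations is a homomorphism. -/
def homOfFun [L.IsAlgebraic] (f : A → B)
    (h : ∀ {n : ℕ} (F : L.Functions n) (a : Fin n → A), f (funMap F a) = funMap F (f ∘ a)) :
    A →[L] B where
  toFun := f
  map_fun' := h
  map_rel' r := isEmptyElim r

/-- The product of two algebras, with componentwise operations. -/
instance prodStructure : L.Structure (A × B) where
  funMap F a := (funMap F fun i => (a i).1, funMap F fun i => (a i).2)
  RelMap r a := RelMap r (fun i => (a i).1) ∧ RelMap r (fun i => (a i).2)

variable (L A B) in
/-- The first projection as a homomorphism. -/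
def fstHom : (A × B) →[L] A where
  toFun := Prod.fst
  map_fun' _ _ := rfl
  map_rel' _ _ h := h.1

variable (L A B) in
/-- The second projection as a homomorphism. -/
def sndHom : (A × B) →[L] B where
  toFun := Prod.snd
  map_fun' _ _ := rfl
  map_rel' _ _ h := h.2

/-- The homomorphism into a product given by its components. -/
def prodHom (f : C →[L] A) (g : C →[L] B) : C →[L] (A × B) where
  toFun c := (f c, g c)
  map_fun' F c := Prod.ext (f.map_fun F c) (g.map_fun F c)
  map_rel' r c h := ⟨f.map_rel r c h, g.map_rel r c h⟩

/-- The product of two homomorphisms. -/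
def prodMapHom {D : Type*} [L.Structure D] (f : A →[L] B) (g : C →[L] D) : (A × C) →[L] (B × D) :=
  prodHom (f.comp (fstHom L A C)) (g.comp (sndHom L A C))

theorem realize_fst {X : Type*} (t : L.Term X) (a : X → A × B) :
    (t.realize a).1 = t.realize fun i => (a i).1 :=
  (HomClass.realize_term (fstHom L A B) (t := t) (v := a)).symm

theorem realize_snd {X : Type*} (t : L.Term X) (a : X → A × B) :
    (t.realize a).2 = t.realize fun i => (a i).2 :=
  (HomClass.realize_term (sndHom L A B) (t := t) (v := a)).symm

/-- The inverse of a bijective homomorphism. -/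
noncomputable def invHom [L.IsAlgebraic] (f : A →[L] B) (hf : Function.Bijective f) : B →[L] A :=
  homOfFun (Equiv.ofBijective f hf).symm fun F b => by
    apply hf.1
    change (Equiv.ofBijective f hf) _ = _
    rw [Equiv.apply_symm_apply, f.map_fun]
    congr 1
    funext i
    exact ((Equiv.ofBijective f hf).apply_symm_apply (b i)).symm

theorem apply_invHom [L.IsAlgebraic] (f : A →[L] B) (hf : Function.Bijective f) (b : B) :
    f (invHom f hf b) = b := (Equiv.ofBijective f hf).apply_symm_apply b

theorem invHom_apply [L.IsAlgebraic] (f : A →[L] B) (hf : Function.Bijective f) (a : A) :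
    invHom f hf (f a) = a := (Equiv.ofBijective f hf).symm_apply_apply a

/-- The algebra `A` in a larger universe. -/
instance uliftStructure : L.Structure (ULift.{w} A) where
  funMap F a := ⟨funMap F fun i => (a i).down⟩
  RelMap r a := RelMap r fun i => (a i).down

variable (L A) in
/-- The isomorphism from `A` to its lift. -/
def upHom : A →[L] ULift.{w} A where
  toFun := ULift.up
  map_fun' _ _ := rfl
  map_rel' _ _ h := h

variable (L A) in
/-- The isomorphism to `A` from its lift. -/
def downHom : ULift.{w} A →[L] A where
  toFun := ULift.down
  map_fun' _ _ := rfl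
  map_rel' _ _ h := h

end Algebras

section Satisfies

variable {E : Set (L.Term ℕ × L.Term ℕ)}
variable {A : Type*} {B : Type*} [L.Structure A] [L.Structure B]

theorem Satisfies.of_injective (hB : Satisfies E B) (f : A →[L] B) (hf : Function.Injective f) :
    Satisfies E A := by
  intro p hp a
  apply hf
  rw [← HomClass.realize_term, ← HomClass.realize_term]
  exact hB p hp _

theorem Satisfies.of_surjective (hA : Satisfies E A) (f : A →[L] B) (hf : Function.Surjective f) :
    Satisfies E B := by
  intro p hp b
  obtain ⟨a, rfl⟩ : ∃ a : ℕ → A, f ∘ a = b :=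
    ⟨fun i => (hf (b i)).choose, funext fun i => (hf (b i)).choose_spec⟩
  rw [HomClass.realize_term, HomClass.realize_term, hA p hp a]

theorem Satisfies.prod (hA : Satisfies E A) (hB : Satisfies E B) : Satisfies E (A × B) := by
  intro p hp a
  apply Prod.ext
  · rw [realize_fst, realize_fst, hA p hp]
  · rw [realize_snd, realize_snd, hB p hp]

theorem Satisfies.ulift (hA : Satisfies E A) : Satisfies E (ULift.{w} A) :=
  hA.of_injective (downHom L A) ULift.down_injective

/-- Every congruence is the kernel of a surjective homomorphism. -/
theorem exists_quotient [L.IsAlgebraic] {A : Type w} [L.Structure A] (hA : Satisfies E A)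
    (r : A → A → Prop) (hr : Equivalence r)
    (hc : ∀ {n : ℕ} (F : L.Functions n) (a b : Fin n → A), (∀ i, r (a i) (b i)) →
      r (funMap F a) (funMap F b)) :
    ∃ (Q : Type w) (_ : L.Structure Q) (π : A →[L] Q),
      Satisfies E Q ∧ Function.Surjective π ∧ ∀ a b, π a = π b ↔ r a b := by
  let s : Setoid A := ⟨r, hr⟩
  -- Operations act on chosen representatives; by `hc` the choice is irrelevant, so the quotient map
  -- is a homomorphism.
  let str : L.Structure (Quotient s) :=
    { funMap := fun F a => Quotient.mk s (funMap F fun i => (a i).out)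
      RelMap := fun r _ => isEmptyElim r }
  let π : A →[L] Quotient s := homOfFun (Quotient.mk s) fun F a =>
    Quotient.sound (hc F _ _ fun i => hr.symm (Quotient.exact (s := s) (Quotient.out_eq (Quotient.mk s (a i)))))
  have hπ : Function.Surjective π := Quotient.mk_surjective
  exact ⟨Quotient s, str, π, hA.of_surjective π hπ, hπ, fun a b => Quotient.eq⟩

end Satisfies

/-! ### The universal property of free algebras -/

section Free

variable {E : Set (L.Term ℕ × L.Term ℕ)}
variable {X : Type x} {A : Type*} [L.Structure A] {B : Type*} [L.Structure B]

theorem TermEq.realize_eq (hA : Satisfies E A) (a : X → A) {s t : L.Term X} (h : TermEq E s t) :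
    s.realize a = t.realize a := by
  induction h with
  | inst p hp σ => simp only [Term.realize_subst]; exact hA p hp _
  | refl => rfl
  | symm _ ih => exact ih.symm
  | trans _ _ ih₁ ih₂ => exact ih₁.trans ih₂
  | congr f a b _ ih => simp only [Term.realize_func, ih]

variable (E) in
/-- The element of the free algebra given by a term. -/
def Free.mk (s : L.Term X) : Free E X := Quotient.mk (termSetoid E X) s

theorem Free.exists_mk {Y : Type*} (a : Y → Free E X) :
    ∃ s : Y → L.Term X, a = fun i => Free.mk E (s i) := by
  choose s hs using fun i => Quotient.exists_rep (s := termSetoid E X) (a i)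
  exact ⟨s, funext fun i => (hs i).symm⟩

variable [L.IsAlgebraic]

theorem funMap_mk {n : ℕ} (F : L.Functions n) (s : Fin n → L.Term X) :
    (funMap F fun i => Free.mk E (s i)) = Free.mk E (Term.func F s) :=
  funMap_quotient_mk' (termSetoid E X) F s

theorem realize_mk {Y : Type*} (t : L.Term Y) (s : Y → L.Term X) :
    t.realize (fun i => Free.mk E (s i)) = Free.mk E (t.subst s) := by
  induction t with
  | var => rfl
  | func F ts ih => simp only [Term.realize_func, ih, funMap_mk, Term.subst]

theorem realize_of (s : L.Term X) : s.realize (Free.of E : X → Free E X) = Free.mk E s := by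
  induction s with
  | var => rfl
  | func F ts ih => simp only [Term.realize_func, ih, funMap_mk]

variable (E X) in
theorem satisfies_free : Satisfies E (Free E X) := by
  intro p hp a
  obtain ⟨s, rfl⟩ := Free.exists_mk a
  rw [realize_mk, realize_mk]
  exact Quotient.sound (TermEq.inst p hp _)

theorem Free.exists_term (a : Free E X) : ∃ s : L.Term X, s.realize (Free.of E) = a := by
  obtain ⟨s, rfl⟩ := Quotient.exists_rep a
  exact ⟨s, realize_of s⟩

theorem Free.hom_ext {f g : Free E X →[L] A} (h : ∀ i, f (Free.of E i) = g (Free.of E i)) :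
    f = g := by
  ext a
  obtain ⟨s, rfl⟩ := a.exists_term
  rw [← HomClass.realize_term, ← HomClass.realize_term]
  congr 1
  exact funext h

/-- The map from the free algebra which extends a map on the generators. -/
def Free.liftFun (hA : Satisfies E A) (a : X → A) (b : Free E X) : A :=
  Quotient.liftOn b (fun s : L.Term X => s.realize a) fun _ _ h => TermEq.realize_eq hA a h

/-- The homomorphism from the free algebra which extends a map on the generators. -/
def Free.lift (hA : Satisfies E A) (a : X → A) : Free E X →[L] A :=
  homOfFun (Free.liftFun hA a) fun F b => by
    obtain ⟨s, rfl⟩ := Free.exists_mk b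
    rw [funMap_mk]
    rfl

@[simp]
theorem Free.lift_of (hA : Satisfies E A) (a : X → A) (i : X) :
    Free.lift hA a (Free.of E i) = a i := rfl

/-- The unique homomorphism from the algebra of constants. -/
def Const.eval (hA : Satisfies E A) : Const E →[L] A := Free.lift hA Empty.elim

theorem Const.hom_ext {f g : Const E →[L] A} : f = g := Free.hom_ext fun i => i.elim

theorem Const.hom_apply_eval (hA : Satisfies E A) (hB : Satisfies E B) (f : A →[L] B)
    (c : Const E) : f (Const.eval hA c) = Const.eval hB c :=
  DFunLike.congr_fun (Const.hom_ext (f := f.comp (Const.eval hA)) (g := Const.eval hB)) c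

theorem Const.toFree_eq_eval (c : Const E) :
    (c.toFree : Free E X) = Const.eval (satisfies_free E X) c := by
  induction c using Quotient.inductionOn with
  | h s =>
    change Free.mk E (s.relabel Empty.elim) = s.realize Empty.elim
    rw [← realize_of, Term.realize_relabel]
    congr 1
    exact funext fun i => i.elim

theorem Const.hom_toFree (hA : Satisfies E A) (f : Free E X →[L] A) (c : Const E) :
    f c.toFree = Const.eval hA c := by
  rw [Const.toFree_eq_eval, Const.hom_apply_eval _ hA]

theorem Const.eval_self (c : Const E) (h : Satisfies E (Const E)) : Const.eval h c = c :=
  DFunLike.congr_fun (Const.hom_ext (f := Const.eval h) (g := Hom.id L _)) c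

end Free

/-! ### The operation given by a term and a system of parameters -/

section Diagonal

variable {A : Type*} {B : Type*} [L.Structure A] [L.Structure B]

/-- The binary operation `t(a, b, c₁, …, cₖ)`. -/
def diag {k : ℕ} (t : L.Term (Fin (k + 2))) (c : Fin k → A) (a b : A) : A :=
  t.realize (Matrix.vecCons a (Matrix.vecCons b c))

theorem comp_vecCons {α β : Type*} (f : α → β) {n : ℕ} (a : α) (b : Fin n → α) :
    f ∘ Matrix.vecCons a b = Matrix.vecCons (f a) (f ∘ b) := by
  funext i
  refine Fin.cases rfl (fun _ => rfl) i

theorem hom_diag {k : ℕ} (t : L.Term (Fin (k + 2))) (f : A →[L] B) (c : Fin k → A) (a b : A) :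
    f (diag t c a b) = diag t (f ∘ c) (f a) (f b) := by
  rw [diag, ← HomClass.realize_term, comp_vecCons, comp_vecCons, diag]

theorem fst_diag {k : ℕ} (t : L.Term (Fin (k + 2))) (c : Fin k → A × B) (a b : A × B) :
    (diag t c a b).1 = diag t (fun i => (c i).1) a.1 b.1 :=
  hom_diag t (fstHom L A B) c a b

theorem snd_diag {k : ℕ} (t : L.Term (Fin (k + 2))) (c : Fin k → A × B) (a b : A × B) :
    (diag t c a b).2 = diag t (fun i => (c i).2) a.2 b.2 :=
  hom_diag t (sndHom L A B) c a b

variable [L.IsAlgebraic] {E : Set (L.Term ℕ × L.Term ℕ)}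

/-- The identity is assumed only for the generators of `F({x, y})`; the homomorphism `x ↦ a`, `y ↦
b` transports it to `A`. -/
theorem IsDiagonalizing.diag_fst {k : ℕ} {t : L.Term (Fin (k + 2))} {e e' : Fin k → Const E}
    (h : IsDiagonalizing t e e') (hA : Satisfies E A) (a b : A) :
    diag t (fun i => Const.eval hA (e i)) a b = a := by
  have := congrArg (Free.lift hA ![a, b]) h.1
  change Free.lift hA ![a, b] (diag t _ _ _) = _ at this
  rw [hom_diag] at this
  simp only [Free.lift_of] at this
  change diag t _ a b = _ at this
  refine Eq.trans ?_ this
  congr 1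
  funext i
  exact (Const.hom_toFree hA _ _).symm

theorem IsDiagonalizing.diag_snd {k : ℕ} {t : L.Term (Fin (k + 2))} {e e' : Fin k → Const E}
    (h : IsDiagonalizing t e e') (hA : Satisfies E A) (a b : A) :
    diag t (fun i => Const.eval hA (e' i)) a b = b := by
  have := congrArg (Free.lift hA ![a, b]) h.2
  change Free.lift hA ![a, b] (diag t _ _ _) = _ at this
  rw [hom_diag] at this
  simp only [Free.lift_of] at this
  change diag t _ a b = _ at this
  refine Eq.trans ?_ this
  congr 1
  funext i
  exact (Const.hom_toFree hA _ _).symm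

/-- In a product, the parameters `(eᵢ, eᵢ')` make the operation pick the components. -/
theorem IsDiagonalizing.diag_prod {k : ℕ} {t : L.Term (Fin (k + 2))} {e e' : Fin k → Const E}
    (h : IsDiagonalizing t e e') (hA : Satisfies E A) (hB : Satisfies E B) (a b : A × B) :
    diag t (fun i => (Const.eval hA (e i), Const.eval hB (e' i))) a b = (a.1, b.2) := by
  apply Prod.ext
  · rw [fst_diag, h.diag_fst hA]
  · rw [snd_diag, h.diag_snd hB]

end Diagonal

/-! ### Products in the category of algebras -/

namespace Alg

variable {E : Set (L.Term ℕ × L.Term ℕ)}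

/-- A set with an algebra structure which satisfies the identities, as an object. -/
abbrev of (A : Type w) [L.Structure A] (hA : Satisfies E A) : Alg.{u, v, w} E where
  carrier := A
  satisfies := hA

/-- A morphism as a homomorphism. -/
def toHom {A B : Alg.{u, v, w} E} (f : A ⟶ B) : A.carrier →[L] B.carrier := f

/-- A homomorphism as a morphism. -/
def ofHom {A B : Alg.{u, v, w} E} (f : A.carrier →[L] B.carrier) : A ⟶ B := f

@[simp] theorem toHom_comp_apply {A B C : Alg.{u, v, w} E} (f : A ⟶ B) (g : B ⟶ C)
    (a : A.carrier) : toHom (f ≫ g) a = toHom g (toHom f a) := rfl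

theorem toHom_injective {A B : Alg.{u, v, w} E} {f g : A ⟶ B}
    (h : ∀ a, toHom f a = toHom g a) : f = g :=
  FirstOrder.Language.Hom.ext h

theorem hom_inv_apply {A B : Alg.{u, v, w} E} (i : A ≅ B) (b : B.carrier) :
    toHom i.hom (toHom i.inv b) = b := by
  rw [← toHom_comp_apply, i.inv_hom_id]
  rfl

theorem inv_hom_apply {A B : Alg.{u, v, w} E} (i : A ≅ B) (a : A.carrier) :
    toHom i.inv (toHom i.hom a) = a :=
  hom_inv_apply i.symm a

theorem bijective_of_iso {A B : Alg.{u, v, w} E} (i : A ≅ B) : Function.Bijective (toHom i.hom) :=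
  ⟨Function.LeftInverse.injective (inv_hom_apply i),
    Function.RightInverse.surjective (hom_inv_apply i)⟩

/-- A bijective homomorphism is an isomorphism. -/
noncomputable def isoOfBijective [L.IsAlgebraic] {A B : Alg.{u, v, w} E}
    (f : A.carrier →[L] B.carrier) (hf : Function.Bijective f) : A ≅ B where
  hom := ofHom f
  inv := ofHom (invHom f hf)
  hom_inv_id := toHom_injective (invHom_apply f hf)
  inv_hom_id := toHom_injective (apply_invHom f hf)

/-- The cone given by the product of two algebras. -/
def prodFan (A B : Alg.{u, v, w} E) : BinaryFan A B :=
  BinaryFan.mk (P := of (A.carrier × B.carrier) (A.satisfies.prod B.satisfies))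
    (ofHom (fstHom L A.carrier B.carrier)) (ofHom (sndHom L A.carrier B.carrier))

/-- The product of two algebras is a categorical product. -/
def isLimitProdFan (A B : Alg.{u, v, w} E) : IsLimit (prodFan A B) :=
  BinaryFan.isLimitMk (fun s => ofHom (prodHom (toHom s.fst) (toHom s.snd)))
    (fun _ => rfl) (fun _ => rfl)
    (fun _ _ h₁ h₂ => toHom_injective fun a => Prod.ext
      (DFunLike.congr_fun (congrArg toHom h₁) a) (DFunLike.congr_fun (congrArg toHom h₂) a))

instance : HasBinaryProducts (Alg.{u, v, w} E) :=
  have (A B : Alg.{u, v, w} E) : HasLimit (pair A B) := ⟨⟨_, isLimitProdFan A B⟩⟩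
  hasBinaryProducts_of_hasLimit_pair _

/-- The one-element algebra. -/
instance unitStructure : L.Structure PUnit.{w + 1} where
  funMap _ _ := PUnit.unit
  RelMap _ _ := True

instance : HasTerminal (Alg.{u, v, w} E) :=
  (IsTerminal.ofUniqueHom (Y := of PUnit (fun _ _ _ => rfl))
    (fun _ => ofHom { toFun := fun _ => PUnit.unit })
    (fun _ _ => toHom_injective fun _ => rfl)).hasTerminal

instance : HasFiniteProducts (Alg.{u, v, w} E) :=
  hasFiniteProducts_of_has_binary_and_terminal

variable (A B : Alg.{u, v, w} E)

/-- The components of an element of the categorical product. -/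
noncomputable def unpair : (A ⨯ B : Alg.{u, v, w} E).carrier →[L] (A.carrier × B.carrier) :=
  prodHom (toHom prod.fst) (toHom prod.snd)

theorem unpair_bijective : Function.Bijective (unpair A B) :=
  bijective_of_iso ((limit.isLimit (pair A B)).conePointUniqueUpToIso (isLimitProdFan A B))

variable {A B} in
theorem unpair_map {C D : Alg.{u, v, w} E} (f : A ⟶ C) (g : B ⟶ D)
    (a : (A ⨯ B : Alg.{u, v, w} E).carrier) :
    unpair C D (toHom (prod.map f g) a) =
      (toHom f (unpair A B a).1, toHom g (unpair A B a).2) := by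
  apply Prod.ext
  · change toHom (prod.map f g ≫ prod.fst) a = _
    rw [prod.map_fst]
    rfl
  · change toHom (prod.map f g ≫ prod.snd) a = _
    rw [prod.map_snd]
    rfl

variable [L.IsAlgebraic]

/-- The element of the categorical product with given components. -/
noncomputable def pairHom : (A.carrier × B.carrier) →[L] (A ⨯ B : Alg.{u, v, w} E).carrier :=
  invHom (unpair A B) (unpair_bijective A B)

@[simp]
theorem unpair_pairHom (a : A.carrier × B.carrier) : unpair A B (pairHom A B a) = a :=
  apply_invHom _ _ a

@[simp]
theorem pairHom_unpair (a : (A ⨯ B : Alg.{u, v, w} E).carrier) :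
    pairHom A B (unpair A B a) = a :=
  invHom_apply _ _ a

variable {A B} in
theorem map_pairHom {C D : Alg.{u, v, w} E} (f : A ⟶ C) (g : B ⟶ D)
    (a : A.carrier × B.carrier) :
    toHom (prod.map f g) (pairHom A B a) = pairHom C D (toHom f a.1, toHom g a.2) := by
  apply (unpair_bijective C D).1
  rw [unpair_map, unpair_pairHom, unpair_pairHom]

end Alg

/-! ### Consequences of coextensivity -/

section OfCoextensive

open Alg

variable [L.IsAlgebraic] {E : Set (L.Term ℕ × L.Term ℕ)}

variable (E) in
/-- The initial algebra as an object. -/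
abbrev constAlg : Alg.{u, v, max u w} E :=
  Alg.of (ULift.{w} (Const E)) (satisfies_free E Empty).ulift

/-- The morphism from the initial algebra. -/
def fromConst (A : Alg.{u, v, max u w} E) : constAlg.{u, v, w} E ⟶ A :=
  ofHom ((Const.eval A.satisfies).comp (downHom L (Const E)))

theorem toHom_constAlg {A : Alg.{u, v, max u w} E} (f : constAlg.{u, v, w} E ⟶ A)
    (c : ULift.{w} (Const E)) : toHom f c = Const.eval A.satisfies c.down :=
  DFunLike.congr_fun (Const.hom_ext (f := (toHom f).comp (upHom L (Const E)))
    (g := Const.eval A.satisfies)) c.down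

/-- Every algebra under the square of the initial algebra is a product. -/
theorem IsCoextensive.exists_decomposition (hc : IsCoextensive (Alg.{u, v, max u w} E))
    {Z : Type max u w} [L.Structure Z] (hZ : Satisfies E Z) (h : (Const E × Const E) →[L] Z) :
    ∃ (A B : Alg.{u, v, max u w} E) (φ : Z →[L] (A.carrier × B.carrier)), Function.Bijective φ ∧
      ∀ c, φ (h c) = (Const.eval A.satisfies c.1, Const.eval B.satisfies c.2) := by
  let I : Alg.{u, v, max u w} E := constAlg.{u, v, w} E
  have := hc.isEquivalence_underProd I I
  let d : (ULift.{w} (Const E) × ULift.{w} (Const E)) →[L] (Const E × Const E) :=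
    prodMapHom (downHom L (Const E)) (downHom L (Const E))
  let k : I ⨯ I ⟶ Alg.of Z hZ := ofHom ((h.comp d).comp (unpair I I))
  obtain ⟨⟨P, Q⟩, ⟨i⟩⟩ := Functor.EssSurj.mem_essImage (F := underProd I I) (Under.mk k)
  let j : Alg.of Z hZ ≅ (P.right ⨯ Q.right : Alg.{u, v, max u w} E) :=
    (Under.forget _).mapIso i.symm
  refine ⟨P.right, Q.right, (unpair P.right Q.right).comp (toHom j.hom),
    (unpair_bijective _ _).comp (bijective_of_iso j), fun c => ?_⟩
  have hw : k ≫ j.hom = prod.map P.hom Q.hom := Under.w i.inv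
  have hk : toHom k (pairHom I I (⟨c.1⟩, ⟨c.2⟩)) = h c := by
    change h (d (unpair I I (pairHom I I (⟨c.1⟩, ⟨c.2⟩)))) = h c
    rw [unpair_pairHom]
    rfl
  rw [Hom.comp_apply, ← hk, ← toHom_comp_apply, hw, map_pairHom, unpair_pairHom, toHom_constAlg,
    toHom_constAlg]

/-- Every homomorphism between products under the square of the initial algebra is a product. -/
theorem IsCoextensive.exists_prodMap (hc : IsCoextensive (Alg.{u, v, max u w} E))
    (A B C D : Alg.{u, v, max u w} E)
    (ψ : (A.carrier × B.carrier) →[L] (C.carrier × D.carrier))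
    (hψ : ∀ c c' : Const E, ψ (Const.eval A.satisfies c, Const.eval B.satisfies c') =
      (Const.eval C.satisfies c, Const.eval D.satisfies c')) :
    ∃ (f : A.carrier →[L] C.carrier) (g : B.carrier →[L] D.carrier), ∀ a, ψ a = (f a.1, g a.2) := by
  let I : Alg.{u, v, max u w} E := constAlg.{u, v, w} E
  have := hc.isEquivalence_underProd I I
  let p : Under I × Under I := (Under.mk (fromConst A), Under.mk (fromConst B))
  let q : Under I × Under I := (Under.mk (fromConst C), Under.mk (fromConst D))
  let k : (A ⨯ B : Alg.{u, v, max u w} E) ⟶ (C ⨯ D : Alg.{u, v, max u w} E) :=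
    ofHom ((pairHom C D).comp (ψ.comp (unpair A B)))
  have hk (a) : toHom k (pairHom A B a) = pairHom C D (ψ a) := by
    change pairHom C D (ψ (unpair A B (pairHom A B a))) = _
    rw [unpair_pairHom]
  -- The hypothesis `hψ` says that `k` is a morphism under `I ⨯ I`, so fullness applies to it.
  have hw : prod.map (fromConst A) (fromConst B) ≫ k = prod.map (fromConst C) (fromConst D) := by
    apply toHom_injective
    intro a
    obtain ⟨c, rfl⟩ : ∃ c, pairHom I I c = a := ⟨_, pairHom_unpair I I a⟩
    rw [toHom_comp_apply, map_pairHom, map_pairHom, hk]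
    exact congrArg (pairHom C D) (hψ c.1.down c.2.down)
  let k' : (underProd I I).obj p ⟶ (underProd I I).obj q := Under.homMk k hw
  obtain ⟨m, hm⟩ := (underProd I I).map_surjective k'
  let f : A ⟶ C := m.1.right
  let g : B ⟶ D := m.2.right
  have hm' : prod.map f g = k := congrArg (fun n => n.right) hm
  refine ⟨toHom f, toHom g, fun a => (unpair_pairHom C D _).symm.trans ?_⟩
  rw [← hk a, ← hm', map_pairHom, unpair_pairHom]

end OfCoextensive

/-! ### Decomposition operations -/

/-- A binary operation on an algebra which is an idempotent homomorphism and behaves like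
`((a, b), (c, d)) ↦ (a, d)` on a product. -/
structure IsDecomposition {A : Type*} [L.Structure A] (d : A → A → A) : Prop where
  idem : ∀ a, d a a = a
  map_fun : ∀ {n : ℕ} (F : L.Functions n) (a b : Fin n → A),
    d (funMap F a) (funMap F b) = funMap F fun i => d (a i) (b i)
  rect : ∀ a b c c', d (d a b) (d c c') = d a c'

namespace IsDecomposition

variable {A : Type w} [L.Structure A] {d : A → A → A}

/-- Exchanging the arguments exchanges the two factors, so the second factor needs no separate
construction. -/
theorem flip (h : IsDecomposition (L := L) d) : IsDecomposition (L := L) fun a b => d b a :=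
  ⟨h.idem, fun F a b => h.map_fun F b a, fun a b c c' => h.rect c' c b a⟩

/-- Both sides express that `a` and `b` have the same first component. The right side is visibly an
equivalence relation, the left side is visibly compatible with the operations. -/
theorem rel_iff (h : IsDecomposition (L := L) d) (a b : A) :
    d a b = b ↔ ∀ c, d a c = d b c := by
  refine ⟨fun hab c => ?_, fun hab => by rw [hab, h.idem]⟩
  have := h.rect a b c c
  rwa [hab, h.idem, eq_comm] at this

/-- The first factor of the decomposition. -/
theorem exists_factor [L.IsAlgebraic] {E : Set (L.Term ℕ × L.Term ℕ)}
    (h : IsDecomposition (L := L) d) (hA : Satisfies E A) :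
    ∃ (Q : Type w) (_ : L.Structure Q) (π : A →[L] Q),
      Satisfies E Q ∧ Function.Surjective π ∧ ∀ a b, π a = π b ↔ d a b = b := by
  refine exists_quotient hA (fun a b => d a b = b) ⟨h.idem, fun {a b} hab => ?_,
    fun {a b c} hab hbc => ?_⟩ fun F a b hab => ?_
  · exact (h.rel_iff b a).2 fun c => ((h.rel_iff a b).1 hab c).symm
  · rw [(h.rel_iff a b).1 hab, hbc]
  · rw [h.map_fun]
    exact congrArg _ (funext hab)

end IsDecomposition

/-! ### Sufficiency of the syntactic conditions -/

section Sufficient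

variable [L.IsAlgebraic] {E : Set (L.Term ℕ × L.Term ℕ)}

/-- Once `g` identifies `αⱼ` with `βⱼ`, the values of each `uᵢ` at `α` and at `β` have the same
image, and the links of the chain join these images. -/
theorem IsLinked.map_eq {A : Type*} [L.Structure A] {n m : ℕ} {α β : Fin (n + 1) → PairFree E}
    {a b : PairFree E} (h : IsLinked α β m a b) (g : PairFree E →[L] A)
    (hg : ∀ j, g (α j) = g (β j)) : g a = g b := by
  obtain ⟨p, rfl, rfl, hp⟩ := h
  have step (i) : g ((p i).realize β) = g ((p i).realize α) := by
    rw [← HomClass.realize_term, ← HomClass.realize_term]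
    congr 1
    exact funext fun j => (hg j).symm
  have key (i : Fin (m + 1)) : g ((p 0).realize β) = g ((p i).realize α) := by
    induction i using Fin.induction with
    | zero => exact step 0
    | succ i ih => rw [ih, hp, step]
  exact key _

/-- The homomorphism `(a, b) ↦ h (a, b)` composed with the diagonal evaluates constants. -/
theorem hom_const_diag {Z : Type*} [L.Structure Z] (hZ : Satisfies E Z)
    (h : (Const E × Const E) →[L] Z) (c : Const E) : h (c, c) = Const.eval hZ c := by
  have := Const.hom_apply_eval (satisfies_free E Empty) hZ
    (h.comp (prodHom (Hom.id L _) (Hom.id L _))) c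
  rwa [Const.eval_self] at this

/-- In `I × I` one has `(c, c') = t((c, c), (c', c'), (eᵢ, eᵢ'))`. Applying `h` gives the claim,
because `h` sends the diagonal element `(c, c)` to the constant `c` of `Z`. -/
theorem hom_diag_const {k : ℕ} {t : L.Term (Fin (k + 2))} {e e' : Fin k → Const E}
    (ht : IsDiagonalizing t e e') {Z : Type*} [L.Structure Z] (hZ : Satisfies E Z)
    (h : (Const E × Const E) →[L] Z) (c c' : Const E) :
    diag t (fun i => h (e i, e' i)) (Const.eval hZ c) (Const.eval hZ c') = h (c, c') := by
  have hE := satisfies_free E Empty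
  have := ht.diag_prod hE hE (c, c) (c', c')
  simp only [Const.eval_self] at this
  have := congrArg h this
  rw [hom_diag, hom_const_diag hZ, hom_const_diag hZ] at this
  exact this

/-- The homomorphism from `F(X + U(F(∅)²))` given by values of the variables and by a homomorphism
on the pairs of constants. -/
def pairLift {Z : Type*} [L.Structure Z] (hZ : Satisfies E Z) (h : (Const E × Const E) →[L] Z)
    (a : Var → Z) : PairFree E →[L] Z :=
  Free.lift hZ (Sum.elim a h)

section

variable {k : ℕ} {t : L.Term (Fin (k + 2))} {e e' : Fin k → Const E}
  {Z : Type*} [L.Structure Z] (hZ : Satisfies E Z) (h : (Const E × Const E) →[L] Z) (a : Var → Z)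

@[simp]
theorem pairLift_var (i : Var) : pairLift hZ h a (.var i) = a i := rfl

@[simp]
theorem pairLift_pair (c c' : Const E) : pairLift hZ h a (.pair c c') = h (c, c') := rfl

theorem hom_delta {A : Type*} [L.Structure A] (g : PairFree E →[L] A) (b b' : PairFree E) :
    g (delta t e e' b b') = diag t (fun i => g (.pair (e i) (e' i))) (g b) (g b') :=
  hom_diag t g _ b b'

theorem pairLift_delta_const (ht : IsDiagonalizing t e e') (c c' : Const E) :
    pairLift hZ h a (delta t e e' c.toFree c'.toFree) = h (c, c') := by
  rw [hom_delta, Const.hom_toFree hZ, Const.hom_toFree hZ]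
  exact hom_diag_const ht hZ h c c'

theorem IsPairStep.map_eq (ht : IsDiagonalizing t e e') {b b' : PairFree E}
    (hb : IsPairStep t e e' b b') : pairLift hZ h a b = pairLift hZ h a b' := by
  obtain ⟨c, c', rfl, rfl⟩ := hb
  rw [pairLift_delta_const hZ h a ht, pairLift_pair]

/-- Each `δ(ωᵢ, ωᵢ')` is sent to `h(ωᵢ, ωᵢ')`, so both sides agree because `h` is a homomorphism. -/
theorem IsOpStep.map_eq (ht : IsDiagonalizing t e e') {b b' : PairFree E}
    (hb : IsOpStep t e e' b b') : pairLift hZ h a b = pairLift hZ h a b' := by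
  obtain ⟨l, s, c, c', rfl, rfl⟩ := hb
  rw [pairLift_delta_const hZ h a ht, ← HomClass.realize_term]
  have : (s.realize c, s.realize c') = s.realize fun i => (c i, c' i) :=
    Prod.ext (realize_fst s fun i => (c i, c' i)).symm (realize_snd s fun i => (c i, c' i)).symm
  rw [this, ← HomClass.realize_term]
  congr 1
  exact funext fun i => pairLift_delta_const hZ h a ht _ _

theorem IsElementary.map_eq (ht : IsDiagonalizing t e e') {b b' : PairFree E}
    (hb : IsElementary t e e' b b') : pairLift hZ h a b = pairLift hZ h a b' := by
  rcases hb with rfl | hb | hb | hb | hb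
  · rfl
  · exact hb.map_eq hZ h a ht
  · exact (hb.map_eq hZ h a ht).symm
  · exact hb.map_eq hZ h a ht
  · exact (hb.map_eq hZ h a ht).symm

end

/-- The syntactic conditions for the basic operations give a term which is a decomposition operation
in every algebra under the square of the initial algebra. -/
theorem SyntacticCondition.exists_isDecomposition (hS : SyntacticCondition E (basicOps L)) :
    ∃ (k : ℕ) (t : L.Term (Fin (k + 2))) (e e' : Fin k → Const E), 0 < k ∧
      IsDiagonalizing t e e' ∧ ∀ (Z : Type w) [L.Structure Z], Satisfies E Z →
        ∀ h : (Const E × Const E) →[L] Z,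
          IsDecomposition (L := L) (diag t fun i => h (e i, e' i)) := by
  obtain ⟨k, t, e, e', hk, ht, hT⟩ := hS
  refine ⟨k, t, e, e', hk, ht, fun Z _ hZ h => ?_⟩
  have map_fun : ∀ {n : ℕ} (F : L.Functions n) (a b : Fin n → Z),
      diag t (fun i => h (e i, e' i)) (funMap F a) (funMap F b) =
        funMap F fun i => diag t (fun i => h (e i, e' i)) (a i) (b i) := by
    intro n F a b
    obtain ⟨n', m, α, β, hαβ, -, hs⟩ := hT {⟨n, Term.func F Term.var⟩}
      (Set.singleton_subset_iff.2 ⟨F, rfl⟩) (Set.finite_singleton _)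
    -- The variables that do not occur need a default value `z`. If `Z` is empty, `funMap F a` is
    -- already a contradiction.
    obtain hx | ⟨⟨z⟩⟩ := isEmpty_or_nonempty Z
    · exact hx.elim (funMap F a)
    let q : Var → Z
      | .x => z
      | .fst i => if hi : i < n then a ⟨i, hi⟩ else z
      | .snd i => if hi : i < n then b ⟨i, hi⟩ else z
    have ha (i : Fin n) : q (.fst i) = a i := dif_pos i.2
    have hb (i : Fin n) : q (.snd i) = b i := dif_pos i.2
    have := (hs _ rfl).map_eq (pairLift hZ h q) fun j => (hαβ j).map_eq hZ h q ht
    simp only [hom_delta, pairLift_pair, Term.realize_func, Term.realize_var,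
      FirstOrder.Language.Hom.map_fun, Function.comp_def, pairLift_var, ha, hb] at this
    exact this
  -- Extension from basic operations to all terms; it is needed for `t` itself.
  have map_term {X : Type} (s : L.Term X) (a b : X → Z) :
      diag t (fun i => h (e i, e' i)) (s.realize a) (s.realize b) =
        s.realize fun i => diag t (fun i => h (e i, e' i)) (a i) (b i) := by
    induction s with
    | var => rfl
    | func F ts ih => simp only [Term.realize_func, map_fun, ih]
  refine ⟨fun z => ?_, map_fun, fun a b c d => ?_⟩
  · obtain ⟨n', m, α, β, hαβ, hx, -⟩ := hT ∅ (Set.empty_subset _) Set.finite_empty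
    have := hx.map_eq (pairLift hZ h fun _ => z) fun j => (hαβ j).map_eq hZ h _ ht
    simpa only [hom_delta, pairLift_pair, pairLift_var] using this
  -- Commuting `δ` with `t` at `t(a, c, e) = a` and `t(b, d, e') = d` gives `δ(a, d) = t(δ(a, b),
  -- δ(c, d), δ(eᵢ, eᵢ'))`. Since `δ(eᵢ, eᵢ') = h(eᵢ, eᵢ')`, the right side is `δ(δ(a, b), δ(c,
  -- d))`.
  · have := map_term t
      (Matrix.vecCons a (Matrix.vecCons c fun i => Const.eval hZ (e i)))
      (Matrix.vecCons b (Matrix.vecCons d fun i => Const.eval hZ (e' i)))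
    change diag t _ (diag t _ a c) (diag t _ b d) = _ at this
    rw [ht.diag_fst hZ, ht.diag_snd hZ] at this
    rw [this, diag]
    congr 1
    funext i
    refine Fin.cases rfl (fun i => Fin.cases rfl (fun i => ?_) i) i
    exact (hom_diag_const ht hZ h (e i) (e' i)).symm

end Sufficient

/-! ### The canonical functor is faithful, full and essentially surjective -/

section Sufficient

open Alg

variable [L.IsAlgebraic] {E : Set (L.Term ℕ × L.Term ℕ)}

/-- A homomorphism between products which preserves the pairs of constants is a product. -/
theorem IsDiagonalizing.exists_prodMap {k : ℕ} {t : L.Term (Fin (k + 2))} {e e' : Fin k → Const E}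
    (ht : IsDiagonalizing t e e') (hk : 0 < k) {A B C D : Type*} [L.Structure A] [L.Structure B]
    [L.Structure C] [L.Structure D] (hA : Satisfies E A) (hB : Satisfies E B)
    (hC : Satisfies E C) (hD : Satisfies E D) (ψ : (A × B) →[L] (C × D))
    (hψ : ∀ c c' : Const E, ψ (Const.eval hA c, Const.eval hB c') =
      (Const.eval hC c, Const.eval hD c')) :
    ∃ (f : A →[L] C) (g : B →[L] D), ∀ a, ψ a = (f a.1, g a.2) := by
  let a₀ : A := Const.eval hA (e ⟨0, hk⟩)
  let b₀ : B := Const.eval hB (e ⟨0, hk⟩)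
  -- On both products `(a, b) ↦ (a.1, b.2)` is `t` with constant pairs as parameters, and `ψ`
  -- preserves these. Hence each component of `ψ` depends only on the matching coordinate.
  have key (a b : A × B) : ψ (a.1, b.2) = ((ψ a).1, (ψ b).2) := by
    rw [← ht.diag_prod hA hB a b, hom_diag, ← ht.diag_prod hC hD]
    congr 1
    exact funext fun i => hψ _ _
  let f : A →[L] C := homOfFun (fun a => (ψ (a, b₀)).1) fun F a => by
    have h₁ := congrArg Prod.fst (key (funMap F fun i => (a i, b₀)) (a₀, b₀))
    have h₂ := congrArg Prod.fst (ψ.map_fun F fun i => (a i, b₀))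
    exact h₁.trans h₂
  let g : B →[L] D := homOfFun (fun b => (ψ (a₀, b)).2) fun F b => by
    have h₁ := congrArg Prod.snd (key (a₀, b₀) (funMap F fun i => (a₀, b i)))
    have h₂ := congrArg Prod.snd (ψ.map_fun F fun i => (a₀, b i))
    exact h₁.trans h₂
  exact ⟨f, g, fun a => key (a.1, b₀) (a₀, a.2)⟩

theorem faithful_underProd [Nonempty (Const E)] (X Y : Alg.{u, v, w} E) :
    (underProd X Y).Faithful where
  map_injective {p q m m'} hm := by
    obtain ⟨c⟩ := ‹Nonempty (Const E)›
    have hm' : prod.map m.1.right m.2.right = prod.map m'.1.right m'.2.right :=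
      congrArg (fun n => n.right) hm
    have key (a : p.1.right.carrier) (b : p.2.right.carrier) :
        (toHom m.1.right a, toHom m.2.right b) = (toHom m'.1.right a, toHom m'.2.right b) := by
      have := unpair_map m.1.right m.2.right (pairHom _ _ (a, b))
      rw [hm', unpair_map, unpair_pairHom] at this
      exact this.symm
    apply Prod.ext
    · apply Under.UnderMorphism.ext
      exact toHom_injective fun a =>
        congrArg Prod.fst (key a (Const.eval p.2.right.satisfies c))
    · apply Under.UnderMorphism.ext
      exact toHom_injective fun b =>
        congrArg Prod.snd (key (Const.eval p.1.right.satisfies c) b)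

theorem toHom_eval {A B : Alg.{u, v, w} E} (f : A ⟶ B) (c : Const E) :
    toHom f (Const.eval A.satisfies c) = Const.eval B.satisfies c :=
  Const.hom_apply_eval _ _ _ c

theorem IsDiagonalizing.full_underProd {k : ℕ} {t : L.Term (Fin (k + 2))}
    {e e' : Fin k → Const E} (ht : IsDiagonalizing t e e') (hk : 0 < k) (X Y : Alg.{u, v, w} E) :
    (underProd X Y).Full where
  map_surjective {p q} k' := by
    obtain ⟨⟨⟨⟩, A, i⟩, ⟨⟨⟩, B, j⟩⟩ := p
    obtain ⟨⟨⟨⟩, C, i'⟩, ⟨⟨⟩, D, j'⟩⟩ := q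
    change X ⟶ A at i
    change Y ⟶ B at j
    change X ⟶ C at i'
    change Y ⟶ D at j'
    let r : (A ⨯ B : Alg.{u, v, w} E) ⟶ (C ⨯ D : Alg.{u, v, w} E) := k'.right
    have hr : prod.map i j ≫ r = prod.map i' j' := Under.w k'
    have hr' (a : X.carrier × Y.carrier) : toHom r (pairHom A B (toHom i a.1, toHom j a.2)) =
        pairHom C D (toHom i' a.1, toHom j' a.2) := by
      rw [← map_pairHom, ← map_pairHom, ← hr, toHom_comp_apply]
    obtain ⟨f, g, hfg⟩ := ht.exists_prodMap hk A.satisfies B.satisfies C.satisfies D.satisfies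
      ((unpair C D).comp ((toHom r).comp (pairHom A B))) fun c c' => by
        have := hr' (Const.eval X.satisfies c, Const.eval Y.satisfies c')
        simp only [toHom_eval] at this
        simp only [FirstOrder.Language.Hom.comp_apply, this, unpair_pairHom]
    replace hfg (a : A.carrier × B.carrier) : toHom r (pairHom A B a) = pairHom C D (f a.1, g a.2) := by
      rw [← hfg]
      exact (pairHom_unpair C D _).symm
    have key (x : X.carrier) (y : Y.carrier) :
        (f (toHom i x), g (toHom j y)) = (toHom i' x, toHom j' y) := by
      have := hr' (x, y)
      rw [hfg] at this
      have := congrArg (unpair C D) this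
      rwa [unpair_pairHom, unpair_pairHom] at this
    -- Only compatibility with the constants was used to split the morphism; compatibility with `X`
    -- and `Y` is recovered by filling the other coordinate with a constant.
    have hf : i ≫ ofHom f = i' := toHom_injective fun x =>
      congrArg Prod.fst (key x (Const.eval Y.satisfies (e ⟨0, hk⟩)))
    have hg : j ≫ ofHom g = j' := toHom_injective fun y =>
      congrArg Prod.snd (key (Const.eval X.satisfies (e ⟨0, hk⟩)) y)
    refine ⟨(Under.homMk (ofHom f) hf, Under.homMk (ofHom g) hg), ?_⟩
    apply Under.UnderMorphism.ext
    apply toHom_injective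
    intro a
    obtain ⟨b, rfl⟩ : ∃ b, pairHom A B b = a := ⟨_, pairHom_unpair A B a⟩
    exact (map_pairHom _ _ b).trans (hfg b).symm

theorem IsDiagonalizing.essSurj_underProd {k : ℕ} {t : L.Term (Fin (k + 2))}
    {e e' : Fin k → Const E} (ht : IsDiagonalizing t e e') (hk : 0 < k)
    (hd : ∀ (Z : Type w) [L.Structure Z], Satisfies E Z → ∀ h : (Const E × Const E) →[L] Z,
      IsDecomposition (L := L) (diag t fun i => h (e i, e' i))) (X Y : Alg.{u, v, w} E) :
    (underProd X Y).EssSurj where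
  mem_essImage W := by
    obtain ⟨⟨⟩, Z, r⟩ := W
    change (X ⨯ Y : Alg.{u, v, w} E) ⟶ Z at r
    let H : (X.carrier × Y.carrier) →[L] Z.carrier := (toHom r).comp (pairHom X Y)
    let h : (Const E × Const E) →[L] Z.carrier :=
      H.comp (prodMapHom (Const.eval X.satisfies) (Const.eval Y.satisfies))
    have hZ := hd Z.carrier Z.satisfies h
    -- The parameters of `δ` on `Z` come from `X × Y` through `H`, so `H` carries the rectangular
    -- operation of `X × Y` to `δ`.
    have hH (a b) : diag t (fun i => h (e i, e' i)) (H a) (H b) = H (a.1, b.2) := by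
      rw [← ht.diag_prod X.satisfies Y.satisfies, hom_diag]
      rfl
    obtain ⟨A, _, π, hA, hπ, hπ'⟩ := hZ.exists_factor Z.satisfies
    obtain ⟨B, _, ρ, hB, hρ, hρ'⟩ := hZ.flip.exists_factor Z.satisfies
    generalize diag t (fun i => h (e i, e' i)) = d at hZ hH hπ' hρ'
    have hπH (x y y') : π (H (x, y)) = π (H (x, y')) := by rw [hπ', hH]
    have hρH (x x' y) : ρ (H (x, y)) = ρ (H (x', y)) := by rw [hρ', hH]
    let x₀ : X.carrier := Const.eval X.satisfies (e ⟨0, hk⟩)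
    let y₀ : Y.carrier := Const.eval Y.satisfies (e ⟨0, hk⟩)
    let f : X.carrier →[L] A := homOfFun (fun x => π (H (x, y₀))) fun F x => by
      -- `y₀` need not be fixed by `F`, but `π ∘ H` ignores the second coordinate.
      rw [hπH _ _ (funMap F fun _ => y₀)]
      exact ((π.comp H).map_fun F fun i => (x i, y₀))
    let g : Y.carrier →[L] B := homOfFun (fun y => ρ (H (x₀, y))) fun F y => by
      rw [hρH _ (funMap F fun _ => x₀)]
      exact ((ρ.comp H).map_fun F fun i => (x₀, y i))
    have hbij : Function.Bijective (prodHom π ρ) := by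
      constructor
      · intro a b hab
        have h₁ := (hπ' a b).1 (congrArg Prod.fst hab)
        have h₂ := (hρ' b a).1 (congrArg Prod.snd hab).symm
        exact h₂.symm.trans h₁
      · rintro ⟨a, b⟩
        obtain ⟨a, rfl⟩ := hπ a
        obtain ⟨b, rfl⟩ := hρ b
        refine ⟨d a b, Prod.ext ((hπ' _ _).2 ?_) ((hρ' _ _).2 ?_)⟩
        · have := hZ.rect a b a a
          rwa [hZ.idem] at this
        · have := hZ.rect b b a b
          rwa [hZ.idem] at this
    let A' : Alg.{u, v, w} E := Alg.of A hA
    let B' : Alg.{u, v, w} E := Alg.of B hB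
    let f' : X ⟶ A' := ofHom f
    let g' : Y ⟶ B' := ofHom g
    have hbij' : Function.Bijective ((pairHom A' B').comp (prodHom π ρ)) :=
      (Function.bijective_iff_has_inverse.2 ⟨unpair A' B', unpair_pairHom A' B',
        pairHom_unpair A' B'⟩).comp hbij
    let j : Z ≅ (A' ⨯ B' : Alg.{u, v, w} E) := isoOfBijective _ hbij'
    have hj : r ≫ j.hom = prod.map f' g' := by
      apply toHom_injective
      intro a
      obtain ⟨⟨x, y⟩, rfl⟩ : ∃ b, pairHom X Y b = a := ⟨_, pairHom_unpair X Y a⟩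
      rw [map_pairHom]
      exact congrArg (pairHom A' B') (Prod.ext (hπH x y y₀) (hρH x x₀ y))
    exact ⟨(Under.mk f', Under.mk g'), ⟨(Under.isoMk j hj).symm⟩⟩

theorem SyntacticCondition.isCoextensive (hS : SyntacticCondition E (basicOps L)) :
    IsCoextensive (Alg.{u, v, w} E) where
  hasFiniteProducts := inferInstance
  isEquivalence_underProd X Y := by
    obtain ⟨k, t, e, e', hk, ht, hd⟩ := hS.exists_isDecomposition
    have : Nonempty (Const E) := ⟨e ⟨0, hk⟩⟩
    exact
      { faithful := faithful_underProd X Y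
        full := ht.full_underProd hk X Y
        essSurj := ht.essSurj_underProd hk hd X Y }

end Sufficient

/-! ### The diagonalizing term of a coextensive variety -/

section Term

variable {V : Type x} {W : Type y}

/-- Every term uses finitely many variables. -/
theorem exists_relabel_fin (s : L.Term V) :
    ∃ (n : ℕ) (g : Fin n → V) (t : L.Term (Fin n)), t.relabel g = s := by
  induction s with
  | var a => exact ⟨1, fun _ => a, Term.var 0, rfl⟩
  | func F ts ih =>
    choose n g t h using ih
    let i := Fintype.equivFin (Σ i, Fin (n i))
    refine ⟨_, fun j => g (i.symm j).1 (i.symm j).2,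
      Term.func F fun j => (t j).relabel fun a => i ⟨j, a⟩, ?_⟩
    simp only [Term.relabel, Term.relabel_relabel]
    congr 1
    funext j
    rw [← h j]
    congr 1
    funext a
    exact congrArg (fun z : Σ i, Fin (n i) => g z.1 z.2) (i.symm_apply_apply ⟨j, a⟩)

theorem exists_binary_term [Nonempty W] (s : L.Term (Fin 2 ⊕ W)) :
    ∃ (k : ℕ) (t : L.Term (Fin (k + 2))) (c : Fin k → W), 0 < k ∧
      ∀ (A : Type w) [L.Structure A] (a : Fin 2 ⊕ W → A),
        diag t (fun i => a (.inr (c i))) (a (.inl 0)) (a (.inl 1)) = s.realize a := by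
  obtain ⟨n, g, t, rfl⟩ := exists_relabel_fin s
  obtain ⟨c₀⟩ := ‹Nonempty W›
  -- The two distinguished variables go to slots 0 and 1, every other occurrence `i` to its own
  -- parameter slot `i + 2`.
  let r (i : Fin n) : Fin (n + 1 + 2) :=
    Sum.elim (fun j : Fin 2 => Fin.castLE (by omega) j) (fun _ => i.castSucc.succ.succ) (g i)
  -- The last parameter is a dummy which makes `k` positive; slots of distinguished variables are
  -- also filled with `c₀`.
  let c : Fin (n + 1) → W := Fin.lastCases c₀ fun i => Sum.elim (fun _ => c₀) id (g i)
  refine ⟨n + 1, t.relabel r, c, n.succ_pos, fun A _ a => ?_⟩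
  rw [diag, Term.realize_relabel, Term.realize_relabel]
  congr 1
  funext i
  simp only [Function.comp_apply, r]
  rcases h : g i with j | b
  · refine Fin.cases rfl (fun j => ?_) j
    rw [Subsingleton.elim j 0]
    rfl
  · simp [c, h]

end Term

section OfCoextensive

open Alg

variable [L.IsAlgebraic] {E : Set (L.Term ℕ × L.Term ℕ)}

/-- If `I` were empty, so would be `I × 1`, and its empty map to `I × I` would be a product of
homomorphisms, one of them `1 → I`. -/
theorem IsCoextensive.nonempty_const (hc : IsCoextensive (Alg.{u, v, max u w} E)) :
    Nonempty (Const E) := by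
  by_contra hE
  rw [not_nonempty_iff] at hE
  let I : Alg.{u, v, max u w} E := constAlg.{u, v, w} E
  have : IsEmpty I.carrier := inferInstanceAs (IsEmpty (ULift (Const E)))
  let U : Alg.{u, v, max u w} E := Alg.of PUnit fun _ _ _ => rfl
  obtain ⟨-, g, -⟩ := IsCoextensive.exists_prodMap.{u, v, w} hc I U I I
    (homOfFun (fun a => isEmptyElim a.1) fun F a => isEmptyElim (funMap F a).1)
    fun c => isEmptyElim c
  exact isEmptyElim (g PUnit.unit)

/-- Let `S ⊆ F({x, y})²` be generated by `(x, x)`, `(y, y)` and all pairs of constants. It is a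
product `A × B`, and its inclusion is a product `f × g`. The element with the first component of
`(x, x)` and the second of `(y, y)` is included as `(x, y)`. So `(x, y)` is a term in the
generators, and the two coordinates of this equation are the identities sought. -/
theorem IsCoextensive.exists_isDiagonalizing (hc : IsCoextensive (Alg.{u, v, max u w} E)) :
    ∃ (k : ℕ) (t : L.Term (Fin (k + 2))) (e e' : Fin k → Const E),
      0 < k ∧ IsDiagonalizing t e e' := by
  have : Nonempty (Const E) := IsCoextensive.nonempty_const.{u, v, w} hc
  let F := Free E (Fin 2)
  have hF : Satisfies E F := satisfies_free E _
  let p : Fin 2 ⊕ (Const E × Const E) → F × F :=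
    Sum.elim (fun i => (Free.of E i, Free.of E i)) fun c => (c.1.toFree, c.2.toFree)
  let q : Free E (Fin 2 ⊕ (Const E × Const E)) →[L] (F × F) := Free.lift (hF.prod hF) p
  let S := q.range
  have hp (i) : p i ∈ S := Hom.mem_range.2 ⟨Free.of E i, rfl⟩
  have hS : Satisfies E S := (hF.prod hF).of_injective S.subtype.toHom Subtype.coe_injective
  let h : (Const E × Const E) →[L] S :=
    (prodMapHom (Const.eval hF) (Const.eval hF)).codRestrict S fun c => by
      have := hp (.inr c)
      simp only [p, Sum.elim_inr, Const.toFree_eq_eval] at this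
      exact this
  obtain ⟨A, B, φ, hφ, hφh⟩ := IsCoextensive.exists_decomposition.{u, v, w} hc hS.ulift
    ((upHom.{u, v, w} L S).comp h)
  let F' : Alg.{u, v, max u w} E := Alg.of (ULift.{w} F) hF.ulift
  let θ : ULift.{w} S →[L] (F'.carrier × F'.carrier) :=
    (prodMapHom (upHom L F) (upHom L F)).comp (S.subtype.toHom.comp (downHom L S))
  have hθ (s : ULift.{w} S) : θ s = (ULift.up s.down.1.1, ULift.up s.down.1.2) := rfl
  obtain ⟨f, g, hfg⟩ := IsCoextensive.exists_prodMap.{u, v, w} hc A B F' F'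
    (θ.comp (invHom φ hφ)) fun c c' => by
      rw [Hom.comp_apply, ← hφh (c, c'), invHom_apply]
      apply Prod.ext
      · exact Const.hom_apply_eval hF F'.satisfies (upHom L F) c
      · exact Const.hom_apply_eval hF F'.satisfies (upHom L F) c'
  replace hfg (s) : θ s = (f (φ s).1, g (φ s).2) := by
    rw [← hfg]
    exact congrArg θ (invHom_apply φ hφ s).symm
  let z (i : Fin 2) : ULift.{w} S := ⟨⟨p (.inl i), hp _⟩⟩
  obtain ⟨s, hs⟩ := hφ.2 ((φ (z 0)).1, (φ (z 1)).2)
  have hs' : s.down.1 = (Free.of E 0, Free.of E 1) := by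
    have h₀ : f (φ (z 0)).1 = ULift.up (Free.of E 0) := (congrArg Prod.fst (hfg (z 0))).symm
    have h₁ : g (φ (z 1)).2 = ULift.up (Free.of E 1) := (congrArg Prod.snd (hfg (z 1))).symm
    have h₂ := hfg s
    rw [hs, h₀, h₁] at h₂
    exact Prod.ext (congrArg (fun a => a.1.down) h₂) (congrArg (fun a => a.2.down) h₂)
  obtain ⟨b, hb⟩ := Hom.mem_range.1 s.down.2
  obtain ⟨r, rfl⟩ := b.exists_term
  rw [hs', ← HomClass.realize_term] at hb
  obtain ⟨k, t, c, hk, ht⟩ := exists_binary_term r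
  have := ht (F × F) p
  rw [show r.realize p = _ from hb] at this
  exact ⟨k, t, fun i => (c i).1, fun i => (c i).2, hk,
    (fst_diag t _ _ _).symm.trans (congrArg Prod.fst this),
    (snd_diag t _ _ _).symm.trans (congrArg Prod.snd this)⟩

/-- In a coextensive variety, an algebra under the square of the initial algebra embeds into a
product so that the diagonalizing term becomes `((a, b), (c, d)) ↦ (a, d)`. -/
theorem IsCoextensive.exists_embedding (hc : IsCoextensive (Alg.{u, v, max u w} E)) {k : ℕ}
    {t : L.Term (Fin (k + 2))} {e e' : Fin k → Const E} (ht : IsDiagonalizing t e e')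
    {Z : Type u} [L.Structure Z] (hZ : Satisfies E Z) (h : (Const E × Const E) →[L] Z) :
    ∃ (A B : Type max u w) (_ : L.Structure A) (_ : L.Structure B) (φ : Z →[L] (A × B)),
      Function.Injective φ ∧
        ∀ a b, φ (diag t (fun i => h (e i, e' i)) a b) = ((φ a).1, (φ b).2) := by
  obtain ⟨A, B, φ, hφ, hφh⟩ := IsCoextensive.exists_decomposition.{u, v, w} hc hZ.ulift
    ((upHom.{u, v, w} L Z).comp h)
  refine ⟨A.carrier, B.carrier, inferInstance, inferInstance, φ.comp (upHom L Z),
    hφ.1.comp ULift.up_injective, fun a b => ?_⟩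
  rw [hom_diag, ← ht.diag_prod A.satisfies B.satisfies]
  congr 1
  exact funext fun i => hφh _

theorem IsCoextensive.diag_self (hc : IsCoextensive (Alg.{u, v, max u w} E)) {k : ℕ}
    {t : L.Term (Fin (k + 2))} {e e' : Fin k → Const E} (ht : IsDiagonalizing t e e')
    {Z : Type u} [L.Structure Z] (hZ : Satisfies E Z) (h : (Const E × Const E) →[L] Z) (a : Z) :
    diag t (fun i => h (e i, e' i)) a a = a := by
  obtain ⟨A, B, _, _, φ, hφ, hφd⟩ := IsCoextensive.exists_embedding.{u, v, w} hc ht hZ h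
  exact hφ (hφd a a)

/-- Terms in a product are evaluated componentwise, so they commute with taking one component from
each of two arguments. -/
theorem IsCoextensive.diag_realize (hc : IsCoextensive (Alg.{u, v, max u w} E)) {k : ℕ}
    {t : L.Term (Fin (k + 2))} {e e' : Fin k → Const E} (ht : IsDiagonalizing t e e')
    {Z : Type u} [L.Structure Z] (hZ : Satisfies E Z) (h : (Const E × Const E) →[L] Z)
    {X : Type*} (s : L.Term X) (a b : X → Z) :
    diag t (fun i => h (e i, e' i)) (s.realize a) (s.realize b) =
      s.realize fun i => diag t (fun i => h (e i, e' i)) (a i) (b i) := by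
  obtain ⟨A, B, _, _, φ, hφ, hφd⟩ := IsCoextensive.exists_embedding.{u, v, w} hc ht hZ h
  apply hφ
  rw [hφd, ← HomClass.realize_term, ← HomClass.realize_term, ← HomClass.realize_term]
  simp only [Function.comp_def, hφd]
  apply Prod.ext
  · rw [realize_fst, realize_fst]
  · rw [realize_snd, realize_snd]

end OfCoextensive

/-! ### Chains of elementary steps -/

section Chains

variable {A : Type*} [L.Structure A]

variable (L) in
/-- `b` arises from `a` when occurrences of `p.2` are replaced by `p.1` for pairs `p ∈ S`. -/
def IsStep (S : Set (A × A)) (a b : A) : Prop :=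
  ∃ s : L.Term S, s.realize (fun p => p.1.2) = a ∧ s.realize (fun p => p.1.1) = b

theorem IsStep.of_mem {S : Set (A × A)} {a b : A} (h : (a, b) ∈ S) : IsStep L S b a :=
  ⟨Term.var ⟨_, h⟩, rfl, rfl⟩

theorem IsStep.swap {S : Set (A × A)} {a b : A} (h : IsStep L (Prod.swap ⁻¹' S) a b) :
    IsStep L S b a := by
  obtain ⟨s, rfl, rfl⟩ := h
  refine ⟨s.relabel fun p => ⟨p.1.swap, p.2⟩, ?_, ?_⟩ <;>
  · rw [Term.realize_relabel]
    rfl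

theorem IsStep.congr {S : Set (A × A)} {n : ℕ} (F : L.Functions n) {a b : Fin n → A}
    (h : ∀ i, IsStep L S (a i) (b i)) : IsStep L S (funMap F a) (funMap F b) := by
  choose s hs hs' using h
  refine ⟨Term.func F s, ?_, ?_⟩
  · simp only [Term.realize_func, hs]
  · simp only [Term.realize_func, hs']

variable (L) in
/-- A chain of `m` steps. -/
def IsChainOf (S : Set (A × A)) (m : ℕ) (a b : A) : Prop :=
  ∃ c : ℕ → A, c 0 = a ∧ c m = b ∧ ∀ i < m, IsStep L S (c i) (c (i + 1))

theorem IsChainOf.swap {S : Set (A × A)} {m : ℕ} {a b : A}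
    (h : IsChainOf L (Prod.swap ⁻¹' S) m a b) : IsChainOf L S m b a := by
  obtain ⟨c, rfl, rfl, hc⟩ := h
  refine ⟨fun i => c (m - i), rfl, by simp, fun i hi => ?_⟩
  have := (hc (m - (i + 1)) (by omega)).swap
  rwa [show m - (i + 1) + 1 = m - i by omega] at this

theorem IsChainOf.trans {S : Set (A × A)} {m n : ℕ} {a b c : A} (h : IsChainOf L S m a b)
    (h' : IsChainOf L S n b c) : IsChainOf L S (m + n) a c := by
  obtain ⟨p, rfl, hp, hp'⟩ := h
  obtain ⟨q, rfl, rfl, hq'⟩ := h'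
  -- The two pieces agree at the junction: `p m = b = q 0`.
  refine ⟨fun i => if i ≤ m then p i else q (i - m), by simp, ?_, fun i hi => ?_⟩
  · rcases Nat.eq_zero_or_pos n with rfl | hn
    · simpa using hp
    · simp [hn.ne']
  · rcases lt_trichotomy i m with h | rfl | h
    · simpa only [if_pos h.le, if_pos (Nat.succ_le_of_lt h)] using hp' i h
    · have := hq' 0 (by omega)
      simpa [hp] using this
    · have := hq' (i - m) (by omega)
      rw [show i - m + 1 = i + 1 - m by omega] at this
      simpa only [if_neg h.not_ge, if_neg (show ¬ i + 1 ≤ m by omega)] using this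

/-- The steps in all arguments are made simultaneously, so the chains must have one common length.
-/
theorem IsChainOf.congr {S : Set (A × A)} {m n : ℕ} (F : L.Functions n) {a b : Fin n → A}
    (h : ∀ i, IsChainOf L S m (a i) (b i)) : IsChainOf L S m (funMap F a) (funMap F b) := by
  choose c hc hc' hs using h
  refine ⟨fun j => funMap F fun i => c i j, ?_, ?_, fun j hj => .congr F fun i => hs i j hj⟩
  · simp only [hc]
  · simp only [hc']

variable (L) in
/-- Finitely many pairs which satisfy `R` suffice for chains of any large length. -/
def IsConnected (R : A → A → Prop) (a b : A) : Prop :=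
  ∃ S : Set (A × A), S.Finite ∧ (∀ p ∈ S, R p.1 p.2) ∧
    ∃ M : ℕ, ∀ S' ⊇ S, ∀ m ≥ M, IsChainOf L S' m a b

/-- Because every larger set and every larger length is allowed, the union of the sets and a bound
for the lengths serve all members of the family. -/
theorem IsConnected.finite {R : A → A → Prop} {ι : Type*} [Finite ι] {a b : ι → A}
    (h : ∀ i, IsConnected L R (a i) (b i)) :
    ∃ S : Set (A × A), S.Finite ∧ (∀ p ∈ S, R p.1 p.2) ∧
      ∃ M : ℕ, ∀ S' ⊇ S, ∀ m ≥ M, ∀ i, IsChainOf L S' m (a i) (b i) := by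
  choose S hS hR M hM using h
  obtain ⟨N, hN⟩ := (Set.finite_range M).bddAbove
  refine ⟨⋃ i, S i, Set.finite_iUnion hS, fun p hp => ?_, N, fun S' hS' m hm i => ?_⟩
  · obtain ⟨i, hi⟩ := Set.mem_iUnion.1 hp
    exact hR i p hi
  · exact hM i S' ((Set.subset_iUnion S i).trans hS') m ((hN ⟨i, rfl⟩).trans hm)

variable {R : A → A → Prop}

/-- The terms of a step take only entries of pairs in `S`, so an element that stays fixed must enter
as a pair `(a, a)`. This is the role of case (a). -/
theorem IsConnected.refl (hR : ∀ a, R a a) (a : A) : IsConnected L R a a :=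
  ⟨{(a, a)}, Set.finite_singleton _, fun p hp => by rw [hp]; exact hR a, 0,
    fun _ hS _ _ => ⟨fun _ => a, rfl, rfl, fun _ _ => .of_mem (hS rfl)⟩⟩

theorem IsConnected.symm (hR : ∀ a b, R a b → R b a) {a b : A} (h : IsConnected L R a b) :
    IsConnected L R b a := by
  obtain ⟨S, hS, hSR, M, hM⟩ := h
  refine ⟨Prod.swap '' S, hS.image _, ?_, M, fun S' hS' m hm => ?_⟩
  · rintro _ ⟨p, hp, rfl⟩
    exact hR _ _ (hSR p hp)
  · exact (hM _ (Set.image_subset_iff.1 hS') m hm).swap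

theorem IsConnected.trans {a b c : A} (h : IsConnected L R a b) (h' : IsConnected L R b c) :
    IsConnected L R a c := by
  obtain ⟨S, hS, hSR, M, hM⟩ := h
  obtain ⟨S', hS', hSR', M', hM'⟩ := h'
  refine ⟨S ∪ S', hS.union hS', fun p hp => hp.elim (hSR p) (hSR' p), M + M',
    fun T hT m hm => ?_⟩
  have := (hM T (Set.subset_union_left.trans hT) M le_rfl).trans
    (hM' T (Set.subset_union_right.trans hT) (m - M) (by omega))
  rwa [show M + (m - M) = m by omega] at this

theorem IsConnected.congr {n : ℕ} (F : L.Functions n) {a b : Fin n → A}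
    (h : ∀ i, IsConnected L R (a i) (b i)) :
    IsConnected L R (funMap F a) (funMap F b) := by
  obtain ⟨S, hS, hR, M, hM⟩ := IsConnected.finite h
  exact ⟨S, hS, hR, M, fun S' hS' m hm => .congr F (hM S' hS' m hm)⟩

theorem IsConnected.of_rel (hR : ∀ a, R a a) {a b : A} (h : R a b) : IsConnected L R b a := by
  -- One step does the work; the pair `(a, a)` pads the chain to any greater length.
  refine ⟨{(a, b), (a, a)}, Set.toFinite _, ?_, 1, fun S hS m hm => ?_⟩
  · rintro p (rfl | rfl)
    exacts [h, hR a]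
  · refine ⟨fun i => if i = 0 then b else a, rfl, if_neg (by omega), fun i _ => ?_⟩
    rcases i with _ | i
    · exact .of_mem (hS (Or.inl rfl))
    · exact .of_mem (hS (Or.inr rfl))

end Chains

/-! ### Necessity of the syntactic conditions -/

section Necessary

variable [L.IsAlgebraic] {E : Set (L.Term ℕ × L.Term ℕ)}

/-- Each of the `m + 1` steps supplies one of `u₀, …, uₘ`, and the `m` inner elements of the chain
supply the linking equations. An enumeration of `S` turns its pairs into `(αⱼ, βⱼ)`. -/
theorem IsChainOf.isLinked {S : Set (PairFree E × PairFree E)} {m n : ℕ} {a b : PairFree E}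
    (h : IsChainOf L S (m + 1) a b) (i : S ≃ Fin (n + 1)) :
    IsLinked (fun j => (i.symm j).1.1) (fun j => (i.symm j).1.2) m a b := by
  obtain ⟨c, rfl, rfl, hc⟩ := h
  choose s hs hs' using fun j : Fin (m + 1) => hc j j.2
  refine ⟨fun j => (s j).relabel i, ?_, ?_, fun j => ?_⟩
  · simpa [Term.realize_relabel, Function.comp_def] using hs 0
  · simpa [Term.realize_relabel, Function.comp_def] using hs' (Fin.last m)
  · have h₁ := hs' j.castSucc
    have h₂ := hs j.succ
    simp only [Term.realize_relabel, Function.comp_def, Equiv.symm_apply_apply]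
    exact h₁.trans h₂.symm

variable {k : ℕ} {t : L.Term (Fin (k + 2))} {e e' : Fin k → Const E}

theorem IsElementary.refl (a : PairFree E) : IsElementary t e e' a a := Or.inl rfl

theorem IsElementary.symm {a b : PairFree E} (h : IsElementary t e e' a b) :
    IsElementary t e e' b a := by
  rcases h with h | h | h | h | h
  · exact Or.inl h.symm
  · exact Or.inr (Or.inr (Or.inl h))
  · exact Or.inr (Or.inl h)
  · exact Or.inr (Or.inr (Or.inr (Or.inr h)))
  · exact Or.inr (Or.inr (Or.inr (Or.inl h)))

variable (t e e') in
/-- The largest quotient of `F(X + U(F(∅)²))` in which the pairs of constants form a homomorphic image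
of the square of the initial algebra. -/
theorem exists_pairQuotient :
    ∃ (Q : Type u) (_ : L.Structure Q) (π : PairFree E →[L] Q)
      (h : (Const E × Const E) →[L] Q), Satisfies E Q ∧ (∀ c c', h (c, c') = π (PairFree.pair c c')) ∧
        ∀ a b, π a = π b → IsConnected L (IsElementary t e e') a b := by
  obtain ⟨Q, _, π, hQ, -, hπ⟩ := exists_quotient (satisfies_free E (Var ⊕ (Const E × Const E)))
    (IsConnected L (IsElementary t e e'))
    ⟨.refl .refl, .symm fun _ _ => .symm, .trans⟩ fun F _ _ => .congr F
  have hel {a b : PairFree E} (h : IsElementary t e e' a b) : π a = π b :=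
    ((hπ b a).2 (.of_rel .refl h)).symm
  have hpair (c c' : Const E) : π (PairFree.pair c c') = π (delta t e e' c.toFree c'.toFree) :=
    hel (Or.inr (Or.inl ⟨c, c', rfl, rfl⟩))
  refine ⟨Q, inferInstance, π, homOfFun (fun c => π (PairFree.pair c.1 c.2)) fun {n} F c => ?_, hQ,
    fun _ _ => rfl, fun a b => (hπ a b).1⟩
  -- This pair identifies `F(δ(ωᵢ, ωᵢ'))` with `δ` of the two values of `F`; pair steps then replace
  -- every `δ` of constants by a generator, which makes `(ω, ω') ↦ π(ω, ω')` a homomorphism.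
  have hop : IsOpStep t e e'
      (funMap F fun i => delta t e e' (c i).1.toFree (c i).2.toFree)
      (delta t e e' (funMap F fun i => (c i).1).toFree (funMap F fun i => (c i).2).toFree) :=
    ⟨n, Term.func F Term.var, fun i => (c i).1, fun i => (c i).2, rfl, rfl⟩
  have := hel (Or.inr (Or.inr (Or.inr (Or.inl hop))))
  rw [← hpair, π.map_fun] at this
  refine this.symm.trans ?_
  congr 1
  exact funext fun i => (hpair _ _).symm

theorem IsCoextensive.syntacticCondition (hc : IsCoextensive (Alg.{u, v, max u w} E)) :
    SyntacticCondition E Set.univ := by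
  obtain ⟨k, t, e, e', hk, ht⟩ := IsCoextensive.exists_isDiagonalizing.{u, v, w} hc
  refine ⟨k, t, e, e', hk, ht, fun T _ hT => ?_⟩
  obtain ⟨Q, _, π, h, hQ, hπ, hcon⟩ := exists_pairQuotient t e e'
  have hδ (a b) : π (delta t e e' a b) = diag t (fun i => h (e i, e' i)) (π a) (π b) := by
    simp only [hom_delta, hπ]
  -- The index `none` stands for `δ(x, x) = x`, so that one finite system serves it together with
  -- all of `T`.
  let p : Option T → PairFree E
    | none => delta t e e' (.var .x) (.var .x)
    | some s => delta t e e' (s.1.2.realize fun i : Fin s.1.1 => PairFree.var (.fst i))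
        (s.1.2.realize fun i : Fin s.1.1 => PairFree.var (.snd i))
  let q : Option T → PairFree E
    | none => .var .x
    | some s => s.1.2.realize fun i : Fin s.1.1 => delta t e e' (.var (.fst i)) (.var (.snd i))
  have hpq (i) : IsConnected L (IsElementary t e e') (p i) (q i) := by
    apply hcon
    rcases i with _ | s
    · exact (hδ _ _).trans (IsCoextensive.diag_self.{u, v, w} hc ht hQ h _)
    · simp only [p, q, hδ, ← HomClass.realize_term, Function.comp_def]
      exact IsCoextensive.diag_realize.{u, v, w} hc ht hQ h s.1.2 _ _
  have : Finite T := hT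
  obtain ⟨S, hS, hSR, M, hM⟩ := IsConnected.finite hpq
  -- The added trivial pair ensures that there is at least one pair `(α₀, β₀)`.
  let S' := insert (PairFree.var Var.x, PairFree.var Var.x) S
  have hS' : S'.Finite := hS.insert _
  have : Finite S' := hS'
  obtain ⟨n, ⟨i⟩⟩ := Finite.exists_equiv_fin S'
  obtain _ | n := n
  · exact (i ⟨_, Set.mem_insert _ _⟩).elim0
  -- A chain of `M + 1` steps yields terms `u₀, …, u_M`.
  have hlink (j) := (hM S' (Set.subset_insert _ _) (M + 1) M.le_succ j).isLinked i
  refine ⟨n, M, _, _, fun j => ?_, hlink none, fun s hs => hlink (some ⟨s, hs⟩)⟩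
  obtain hj | hj := (i.symm j).2
  · rw [hj]
    exact .refl _
  · exact hSR _ hj

end Necessary

end Variety

theorem theorem5 (L : FirstOrder.Language.{u, v}) [L.IsAlgebraic]
    (E : Set (L.Term ℕ × L.Term ℕ)) :
    (IsCoextensive (Variety.Alg.{u, v, max u w} E) ↔
      Variety.SyntacticCondition E Set.univ) ∧
    (IsCoextensive (Variety.Alg.{u, v, max u w} E) ↔
      Variety.SyntacticCondition E (Variety.basicOps L)) := by
  have mono : Variety.SyntacticCondition E Set.univ →
      Variety.SyntacticCondition E (Variety.basicOps L) := by
    rintro ⟨k, t, e, e', hk, ht, hT⟩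
    exact ⟨k, t, e, e', hk, ht, fun T _ => hT T (Set.subset_univ T)⟩
  have nec := Variety.IsCoextensive.syntacticCondition.{u, v, w} (E := E)
  exact ⟨⟨nec, fun h => (mono h).isCoextensive⟩, ⟨fun h => mono (nec h), fun h => h.isCoextensive⟩⟩
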